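/- Let $Q_1$ and $Q_2$ be finite-dimensional smooth manifolds (without boundary), let $f : Q_1 \to Q_2$ be a smooth diffeomorphism and let $\lambda \in \mathbb{R}$. Define the scaled cotangent lift $\hat f^{\lambda} : T^*Q_1 \to T^*Q_2$ by sending $\alpha \in T_q^*Q_1$ to the covector $\hat f^{\lambda}(\alpha) \in T^*_{f(q)}Q_2$ given by $$\langle \hat f^{\lambda}(\alpha), v\rangle = \lambda \langle \alpha, T f^{-1}(v)\rangle, \qquad v \in T_{f(q)}Q_2 ;$$ that is, $\hat f^{\lambda} = \lambda \hat f$, where $\hat f = \hat f^{1}$ is the usual cotangent lift. For a manifold $Q$ with cotangent projection $\pi_Q : T^*Q \to Q$, let $\theta_Q$ be the canonical one-form on $T^*Q$, $\langle\theta_Q(\beta), v\rangle = \langle \beta, T\pi_Q \cdot v\rangle$ for $v \in T_\beta(T^*Q)$, and let $\omega_Q = -d\theta_Q$ be the canonical symplectic form. Then $\hat f^{\lambda}$ is a $C^\infty$ map, $$(\hat f^{\lambda})^*\theta_{Q_2} = \lambda\, \theta_{Q_1} \qquad\text{and}\qquad (\hat f^{\lambda})^*\omega_{Q_2} = \lambda\,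 \omega_{Q_1}.$$ In particular, if $\lambda > 0$, then $\hat f^{\lambda}$ is conformally symplectic with parameter $\lambda$, where a $C^\infty$ map $g : (M_1,\omega_1) \to (M_2,\omega_2)$ is called conformally symplectic with parameter $c$ if $c > 0$ and $g^*\omega_2 = c\,\omega_1$. -/

import Mathlib

open scoped Manifold ContDiff Bundle

noncomputable section

namespace ConformalSymplectic

section Forms

variable {E : Type*} [NormedAddCommGroup E] [NormedSpace ℝ E]
  {H : Type*} [TopologicalSpace H] (I : ModelWithCorners ℝ E H)
  (M : Type*) [TopologicalSpace M] [ChartedSpace H M]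

/-- (Not necessarily smooth) differential `k`-forms on a manifold `M`. -/
abbrev DiffForm (k : ℕ) : Type _ :=
  ∀ x : M, TangentSpace I x [⋀^Fin k]→L[ℝ] ℝ

variable {I M}

/-- The coordinate expression of a `k`-form in the preferred chart at `x`: its pullback under the
inverse of that chart, a `k`-form on the model space (meaningful on the target of the chart). -/
def DiffForm.inChart {k : ℕ} (η : DiffForm I M k) (x : M) (y : E) : E [⋀^Fin k]→L[ℝ] ℝ :=
  (η ((extChartAt I x).symm y)).compContinuousLinearMap
    (mfderivWithin 𝓘(ℝ, E) I (extChartAt I x).symm (Set.range I) y)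

/-- The exterior derivative of a differential form on a manifold: at `x`, take the exterior
derivative of the coordinate expression of the form in the chart at `x`, and transport it back
to `T_x M` by the derivative of the chart. -/
def DiffForm.extDeriv {k : ℕ} (η : DiffForm I M k) : DiffForm I M (k + 1) := fun x ↦
  (_root_.extDerivWithin (DiffForm.inChart η x) (Set.range I) (extChartAt I x x)).compContinuousLinearMap
    (mfderiv I 𝓘(ℝ, E) (extChartAt I x) x)

variable {E' : Type*} [NormedAddCommGroup E'] [NormedSpace ℝ E']
  {H' : Type*} [TopologicalSpace H'] {I' : ModelWithCorners ℝ E' H'}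
  {M' : Type*} [TopologicalSpace M'] [ChartedSpace H' M']

variable (I) in
/-- The pullback `f^* η`, that is `(f^* η)_x (v₁, …, vₖ) = η_{f x} (T_x f v₁, …, T_x f vₖ)`. -/
def DiffForm.pullback {k : ℕ} (f : M → M') (η : DiffForm I' M' k) : DiffForm I M k := fun x ↦
  (η (f x)).compContinuousLinearMap (mfderiv I I' f x)

/-- `f : (M, η) → (M', η')` is conformally symplectic with parameter `c`: it is smooth, `c > 0`
and `f^* η' = c η`. -/
structure IsConformallySymplectic (η : DiffForm I M 2) (η' : DiffForm I' M' 2) (c : ℝ)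
    (f : M → M') : Prop where
  contMDiff : ContMDiff I I' ∞ f
  pos : 0 < c
  pullback_eq : DiffForm.pullback I f η' = c • η

end Forms

section Cotangent

variable (E : Type*) [NormedAddCommGroup E] [NormedSpace ℝ E]
  (Q : Type*) [TopologicalSpace Q] [ChartedSpace E Q] [IsManifold 𝓘(ℝ, E) ∞ Q]

/-- The cotangent bundle `T^*Q`: the total space of the bundle of continuous linear maps from the
tangent bundle to the trivial line bundle, with its topology and manifold structure of a smooth
vector bundle over `Q`. -/
abbrev CotangentBundle : Type _ :=
  Bundle.TotalSpace (E →L[ℝ] ℝ)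
    (fun q : Q ↦ TangentSpace 𝓘(ℝ, E) q →L[ℝ] Bundle.Trivial Q ℝ q)

/-- The model with corners of `T^*Q`. -/
abbrev cotangentModel : ModelWithCorners ℝ (E × (E →L[ℝ] ℝ)) (ModelProd E (E →L[ℝ] ℝ)) :=
  𝓘(ℝ, E).prod 𝓘(ℝ, E →L[ℝ] ℝ)

/-- The canonical one-form `θ_Q` on `T^*Q`: `θ_Q(β)(v) = β (T π_Q v)` for `v ∈ T_β (T^*Q)`,
where `π_Q : T^*Q → Q` is the projection. -/
def canonicalOneForm : DiffForm (cotangentModel E) (CotangentBundle E Q) 1 := fun β ↦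
  ContinuousAlternatingMap.ofSubsingleton ℝ
    (TangentSpace (cotangentModel E) β) ℝ (0 : Fin 1)
    (ContinuousLinearMap.comp (β.2 : TangentSpace 𝓘(ℝ, E) β.1 →L[ℝ] ℝ)
      (mfderiv (cotangentModel E) 𝓘(ℝ, E)
        (Bundle.TotalSpace.proj : CotangentBundle E Q → Q) β))

/-- The canonical symplectic form `ω_Q = -dθ_Q` on `T^*Q`. -/
def canonicalSymplecticForm : DiffForm (cotangentModel E) (CotangentBundle E Q) 2 :=
  -DiffForm.extDeriv (canonicalOneForm E Q)

variable {E Q}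
  {E' : Type*} [NormedAddCommGroup E'] [NormedSpace ℝ E']
  {Q' : Type*} [TopologicalSpace Q'] [ChartedSpace E' Q'] [IsManifold 𝓘(ℝ, E') ∞ Q']

/-- The scaled cotangent lift `T^*Q → T^*Q'` of a diffeomorphism `f : Q → Q'` with parameter `c`:
a covector `α ∈ T_q^* Q` is sent to the covector `v ↦ c α (T f⁻¹ v)` at `f q`. Here
`T f⁻¹` at `f q` takes values in the tangent space at `f⁻¹ (f q)`, which is the tangent space
at `q`. -/
def scaledCotangentLift (c : ℝ) (f : Q ≃ₘ^∞⟮𝓘(ℝ, E), 𝓘(ℝ, E')⟯ Q') (α : CotangentBundle E Q) :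
    CotangentBundle E' Q' :=
  ⟨f α.1, c • ContinuousLinearMap.comp (α.2 : TangentSpace 𝓘(ℝ, E) α.1 →L[ℝ] ℝ)
    (mfderiv 𝓘(ℝ, E') 𝓘(ℝ, E) f.symm (f α.1))⟩

end Cotangent

end ConformalSymplectic

end

/-! The lift covers `f`, so T f⁻¹ ∘ Tπ₂ ∘ T f̂ = T f⁻¹ ∘ T f ∘ Tπ₁ = Tπ₁. Evaluating θ at the lifted
covector therefore gives c α(Tπ₁ v), which is `pullback_canonicalOneForm`. The identity for ω = -dθ
follows because d is linear and commutes with pullback (`DiffForm.extDeriv_pullback`). The latter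
needs θ to be differentiable in charts, which holds because θ is p dq there
(`inChart_canonicalOneForm`). Smoothness of the lift is read off in bundle coordinates. -/

noncomputable section

namespace ConformalSymplectic

open Set Filter Topology

/-! ### Naturality of the exterior derivative -/

section Naturality

variable {E : Type*} [NormedAddCommGroup E] [NormedSpace ℝ E]
  {H : Type*} [TopologicalSpace H] {I : ModelWithCorners ℝ E H}
  {M : Type*} [TopologicalSpace M] [ChartedSpace H M]
  {E' : Type*} [NormedAddCommGroup E'] [NormedSpace ℝ E']
  {H' : Type*} [TopologicalSpace H'] {I' : ModelWithCorners ℝ E' H'}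
  {M' : Type*} [TopologicalSpace M'] [ChartedSpace H' M']

/-- All tangent spaces are definitionally the model space, so the base point can be changed without
casting vectors. -/
theorem DiffForm.apply_congr {k : ℕ} (η : DiffForm I M k) {p q : M} (h : p = q)
    (v : Fin k → E) : η p v = η q v := by
  subst h; rfl

/-- At the centre of a chart, the derivative of the chart is the identity, so that the exterior
derivative is that of the coordinate expression. -/
theorem DiffForm.extDeriv_apply [IsManifold I 1 M] {k : ℕ} (η : DiffForm I M k) (x : M) :
    DiffForm.extDeriv η x =
      _root_.extDerivWithin (DiffForm.inChart η x) (range I) (extChartAt I x x) := by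
  ext v
  have h : ∀ w : E, mfderiv I 𝓘(ℝ, E) (extChartAt I x) x w = w := fun w ↦
    DFunLike.congr_fun (mfderiv_extChartAt_self (I := I) (x := x)) w
  exact congrArg (_root_.extDerivWithin (DiffForm.inChart η x) (range I) (extChartAt I x x))
    (funext fun i ↦ h (v i))

theorem DiffForm.extDeriv_smul {k : ℕ} (c : ℝ) (η : DiffForm I M k) :
    DiffForm.extDeriv (c • η) = c • DiffForm.extDeriv η := by
  funext x
  have h : DiffForm.inChart (c • η) x = c • DiffForm.inChart η x := by
    funext y; ext v; rfl
  simp only [DiffForm.extDeriv, h]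
  have hs := _root_.extDerivWithin_smul c (DiffForm.inChart η x)
    (I.uniqueDiffOn (extChartAt I x x) (mem_range_self _))
  ext v
  exact DFunLike.congr_fun hs _

/-- Pullback commutes with coordinate expressions. -/
theorem DiffForm.inChart_pullback [IsManifold I 1 M] [IsManifold I' 1 M'] {k : ℕ}
    (η : DiffForm I' M' k) {g : M → M'} (hg : MDifferentiable I I' g) (x : M) {y : E}
    (hy : y ∈ (extChartAt I x).target)
    (hgy : g ((extChartAt I x).symm y) ∈ (extChartAt I' (g x)).source) :
    DiffForm.inChart (DiffForm.pullback I g η) x y =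
      (DiffForm.inChart η (g x) (writtenInExtChartAt I I' x g y)).compContinuousLinearMap
        (fderivWithin ℝ (writtenInExtChartAt I I' x g) (range I) y) := by
  set G := writtenInExtChartAt I I' x g with hG
  have hyr : y ∈ range I := extChartAt_target_subset_range x hy
  have hu : UniqueMDiffWithinAt 𝓘(ℝ, E) (range I) y := (I.uniqueDiffOn y hyr).uniqueMDiffWithinAt
  have hGy : G y ∈ (extChartAt I' (g x)).target := (extChartAt I' (g x)).map_source hgy
  have hsymm := mdifferentiableWithinAt_extChartAt_symm (I := I) hy
  have hsymm' := mdifferentiableWithinAt_extChartAt_symm (I := I') hGy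
  have hgd := (hg ((extChartAt I x).symm y))
  have hGd : MDifferentiableWithinAt 𝓘(ℝ, E) 𝓘(ℝ, E') G (range I) y :=
    (mdifferentiableAt_extChartAt (by simpa using hgy)).comp_mdifferentiableWithinAt y
      (hgd.comp_mdifferentiableWithinAt y hsymm)
  have hmaps : range I ⊆ G ⁻¹' range I' := fun z _ ↦ by
    simp only [hG, writtenInExtChartAt, extChartAt, mem_preimage]
    exact mem_range_self _
  have hpt : (extChartAt I' (g x)).symm (G y) = g ((extChartAt I x).symm y) :=
    (extChartAt I' (g x)).left_inv hgy
  have hsrc : ∀ᶠ z in 𝓝[range I] y, g ((extChartAt I x).symm z) ∈ (extChartAt I' (g x)).source :=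
    (hgd.continuousAt.comp_continuousWithinAt hsymm.continuousWithinAt).preimage_mem_nhdsWithin
      ((isOpen_extChartAt_source (g x)).mem_nhds hgy)
  -- Both sides of the claim evaluate `η` on the derivative of this one map, factored in two ways by
  -- the chain rule.
  have heq : (extChartAt I' (g x)).symm ∘ G =ᶠ[𝓝[range I] y] g ∘ (extChartAt I x).symm := by
    filter_upwards [hsrc] with z hz using (extChartAt I' (g x)).left_inv hz
  have h1 := mfderivWithin_comp y hsymm' hGd hmaps hu
  have h2 := mfderiv_comp_mfderivWithin y hgd hsymm hu
  rw [heq.mfderivWithin_eq hpt] at h1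
  have key : ∀ w : E, mfderivWithin 𝓘(ℝ, E') I' (extChartAt I' (g x)).symm (range I') (G y)
      (fderivWithin ℝ G (range I) y w) = mfderiv I I' g ((extChartAt I x).symm y)
        (mfderivWithin 𝓘(ℝ, E) I (extChartAt I x).symm (range I) y w) := fun w ↦ by
    rw [← mfderivWithin_eq_fderivWithin]
    exact (DFunLike.congr_fun h1 w).symm.trans (DFunLike.congr_fun h2 w)
  ext v
  refine Eq.trans ?_ (DiffForm.apply_congr η hpt.symm _)
  refine congrArg (η (g ((extChartAt I x).symm y))) (funext fun i ↦ ?_)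
  exact (key (v i)).symm

/-- The exterior derivative commutes with pullback under smooth maps. -/
theorem DiffForm.extDeriv_pullback [IsManifold I ∞ M] [IsManifold I' ∞ M'] {k : ℕ}
    (η : DiffForm I' M' k) {g : M → M'} (hg : ContMDiff I I' ∞ g)
    (hη : ∀ x : M', DifferentiableWithinAt ℝ (DiffForm.inChart η x) (range I')
      (extChartAt I' x x)) :
    DiffForm.extDeriv (DiffForm.pullback I g η) = DiffForm.pullback I g (DiffForm.extDeriv η) := by
  have : IsManifold I 1 M := .of_le (n := ∞) (by simp)
  have : IsManifold I' 1 M' := .of_le (n := ∞) (by simp)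
  funext x
  have hgd : MDifferentiable I I' g := hg.mdifferentiable (by simp)
  set G := writtenInExtChartAt I I' x g with hG
  have hx : extChartAt I x x ∈ range I := mem_range_self _
  have hGx : G (extChartAt I x x) = extChartAt I' (g x) (g x) := by simp [hG, writtenInExtChartAt]
  have hmaps : MapsTo G (range I) (range I') := fun z _ ↦ by
    simp only [hG, writtenInExtChartAt, extChartAt]
    exact mem_range_self _
  -- The exterior derivative depends only on the germ, so agreement near the centre of the chart
  -- reduces the claim to the model space.
  have hev : DiffForm.inChart (DiffForm.pullback I g η) x =ᶠ[𝓝[range I] (extChartAt I x x)]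
      fun y ↦ (DiffForm.inChart η (g x) (G y)).compContinuousLinearMap
        (fderivWithin ℝ G (range I) y) := by
    have hc : ContinuousWithinAt (g ∘ (extChartAt I x).symm) (range I) (extChartAt I x x) := by
      refine ContinuousAt.comp_continuousWithinAt ?_
        (continuousAt_extChartAt_symm x).continuousWithinAt
      exact hg.continuous.continuousAt
    have hsrc := hc.preimage_mem_nhdsWithin
      ((isOpen_extChartAt_source (I := I') (g x)).mem_nhds (by simp))
    filter_upwards [extChartAt_target_mem_nhdsWithin x, hsrc] with y hy hgy
    exact DiffForm.inChart_pullback η hgd x hy hgy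
  have hGd : ContDiffWithinAt ℝ ∞ G (range I) (extChartAt I x x) :=
    (contMDiffAt_iff.1 (hg x)).2
  have hηx : DifferentiableWithinAt ℝ (DiffForm.inChart η (g x)) (range I')
      (G (extChartAt I x x)) := by rw [hGx]; exact hη (g x)
  have hpb := _root_.extDerivWithin_pullback hηx hGd (by simpa using ENat.LEInfty.out)
    I.uniqueDiffOn (I.range_subset_closure_interior hx) hx hmaps
  have hm : mfderiv I I' g x = fderivWithin ℝ G (range I) (extChartAt I x x) :=
    (hgd x).mfderiv
  ext v
  have h1 := (hev.extDerivWithin_eq_of_mem hx).trans hpb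
  rw [hGx] at h1
  have h2 := DiffForm.extDeriv_apply (DiffForm.pullback I g η) x
  have h3 := DiffForm.extDeriv_apply η (g x)
  rw [h2]
  unfold DiffForm.pullback at h1 ⊢
  rw [h3, hm]
  exact DFunLike.congr_fun h1 v

end Naturality

theorem differentiable_ofSubsingleton_comp {V W : Type*} [NormedAddCommGroup V] [NormedSpace ℝ V]
    [NormedAddCommGroup W] [NormedSpace ℝ W] {g : V → W →L[ℝ] ℝ} (hg : Differentiable ℝ g) :
    Differentiable ℝ fun y ↦ ContinuousAlternatingMap.ofSubsingleton ℝ W ℝ (0 : Fin 1) (g y) :=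
  (ContinuousAlternatingMap.ofSubsingletonLIE (𝕜 := ℝ) (E := W) (F := ℝ)
    (0 : Fin 1)).differentiable.comp hg

/-! ### The scaled cotangent lift and the canonical forms -/

section CotangentLift

variable {E : Type*} [NormedAddCommGroup E] [NormedSpace ℝ E]
  {Q : Type*} [TopologicalSpace Q] [ChartedSpace E Q] [IsManifold 𝓘(ℝ, E) ∞ Q]
  {E' : Type*} [NormedAddCommGroup E'] [NormedSpace ℝ E']
  {Q' : Type*} [TopologicalSpace Q'] [ChartedSpace E' Q'] [IsManifold 𝓘(ℝ, E') ∞ Q']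

theorem contMDiff_proj :
    ContMDiff (cotangentModel E) 𝓘(ℝ, E) ∞
      (Bundle.TotalSpace.proj : CotangentBundle E Q → Q) :=
  Bundle.contMDiff_proj _

/-- In bundle coordinates the fibre part is `c` times the composite of two smooth operator-valued
maps: the coordinates of α and those of T f⁻¹. -/
theorem contMDiff_scaledCotangentLift (c : ℝ) (f : Q ≃ₘ^∞⟮𝓘(ℝ, E), 𝓘(ℝ, E')⟯ Q') :
    ContMDiff (cotangentModel E) (cotangentModel E') ∞ (scaledCotangentLift c f) := by
  intro α₀
  have hbase : ContMDiffAt (cotangentModel E) 𝓘(ℝ, E') ∞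
      (fun α : CotangentBundle E Q ↦ f α.1) α₀ := (f.contMDiff.comp contMDiff_proj) α₀
  rw [contMDiffAt_hom_bundle]
  refine ⟨hbase, ?_⟩
  have h1 := ((contMDiffAt_hom_bundle (IB := 𝓘(ℝ, E)) (n := ∞)
    (fun α : CotangentBundle E Q ↦ α) (x₀ := α₀)).1 contMDiffAt_id).2
  have h2 := ContMDiffAt.mfderiv (m := ∞) (n := ∞) (x₀ := α₀) (I := 𝓘(ℝ, E')) (I' := 𝓘(ℝ, E))
    (fun (_ : CotangentBundle E Q) ↦ (f.symm : Q' → Q)) (fun α ↦ f α.1)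
    (ContMDiffAt.comp _ f.symm.contMDiff.contMDiffAt contMDiffAt_snd) hbase (by simp)
  -- Makes `h2` use the same trivialization of the tangent bundle as `h1`.
  have hs : (fun α : CotangentBundle E Q ↦ f.symm (f α.1)) = fun α ↦ α.1 := by
    funext α; exact f.symm_apply_apply _
  rw [hs] at h2
  have hc : ContMDiffAt (cotangentModel E) 𝓘(ℝ, ℝ) ∞ (fun _ : CotangentBundle E Q ↦ c) α₀ :=
    contMDiffAt_const
  refine (hc.smul (h1.clm_comp h2)).congr_of_eventuallyEq ?_
  have hmem : ∀ᶠ α in 𝓝 α₀, α.1 ∈ (trivializationAt E (TangentSpace 𝓘(ℝ, E)) α₀.1).baseSet :=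
    contMDiff_proj.continuous.continuousAt.preimage_mem_nhds
      ((trivializationAt E (TangentSpace 𝓘(ℝ, E)) α₀.1).open_baseSet.mem_nhds
        (FiberBundle.mem_baseSet_trivializationAt' _))
  filter_upwards [hmem] with α hα
  ext v
  have htriv : ∀ (q q' : Q) (r : ℝ),
      (trivializationAt ℝ (Bundle.Trivial Q ℝ) q).continuousLinearMapAt ℝ q' r = r :=
    fun q q' r ↦ by simp
  have htriv' : ∀ (q q' : Q') (r : ℝ),
      (trivializationAt ℝ (Bundle.Trivial Q' ℝ) q).continuousLinearMapAt ℝ q' r = r :=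
    fun q q' r ↦ by simp
  refine (htriv' (f α₀.1) (f α.1) _).trans ?_
  refine Eq.trans ?_ (congrArg (c • ·) (htriv α₀.1 α.1 _).symm)
  -- The trivialization inserted between α and T f⁻¹ cancels over its base set.
  refine congrArg (fun w ↦ c • α.2 w) ?_
  exact ((trivializationAt E (TangentSpace 𝓘(ℝ, E)) α₀.1).symmL_continuousLinearMapAt hα _).symm

theorem pullback_canonicalOneForm (c : ℝ) (f : Q ≃ₘ^∞⟮𝓘(ℝ, E), 𝓘(ℝ, E')⟯ Q') :
    DiffForm.pullback (cotangentModel E) (scaledCotangentLift c f) (canonicalOneForm E' Q') =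
      c • canonicalOneForm E Q := by
  funext α
  have hf := (f.contMDiff.mdifferentiable (by simp)) α.1
  have hfs := (f.symm.contMDiff.mdifferentiable (by simp)) (f α.1)
  have hpr : MDifferentiableAt (cotangentModel E) 𝓘(ℝ, E)
      (Bundle.TotalSpace.proj : CotangentBundle E Q → Q) α :=
    contMDiff_proj.mdifferentiable (by simp) α
  have h1 := mfderiv_comp α
    (contMDiff_proj.mdifferentiable (by simp) (scaledCotangentLift c f α))
    ((contMDiff_scaledCotangentLift c f).mdifferentiable (by simp) α)
  have h2 := mfderiv_comp α hf hpr
  have h3 := mfderiv_comp α.1 hfs hf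
  have h4 : (f.symm : Q' → Q) ∘ f = id := funext f.symm_apply_apply
  rw [h4, mfderiv_id] at h3
  ext v
  change c • α.2 (mfderiv 𝓘(ℝ, E') 𝓘(ℝ, E) f.symm (f α.1)
    (mfderiv (cotangentModel E') 𝓘(ℝ, E')
      (Bundle.TotalSpace.proj : CotangentBundle E' Q' → Q') (scaledCotangentLift c f α)
      (mfderiv (cotangentModel E) (cotangentModel E') (scaledCotangentLift c f) α (v 0)))) =
    c • α.2 (mfderiv (cotangentModel E) 𝓘(ℝ, E)
      (Bundle.TotalSpace.proj : CotangentBundle E Q → Q) α (v 0))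
  congr 2
  -- π₂ ∘ f̂ and f ∘ π₁ agree definitionally, so `h1` and `h2` differentiate the same map.
  have e1 := (DFunLike.congr_fun h1 (v 0)).symm.trans (DFunLike.congr_fun h2 (v 0))
  refine (congrArg (mfderiv 𝓘(ℝ, E') 𝓘(ℝ, E) f.symm (f α.1)) e1).trans ?_
  exact (DFunLike.congr_fun h3 _).symm

/-- In bundle charts, the cotangent projection is the first projection. -/
theorem proj_extChartAt_symm (β : CotangentBundle E Q) {y : E × (E →L[ℝ] ℝ)}
    (hy : y ∈ (extChartAt (cotangentModel E) β).target) :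
    ((extChartAt (cotangentModel E) β).symm y).1 ∈ (chartAt E β.1).source ∧
      extChartAt 𝓘(ℝ, E) β.1 ((extChartAt (cotangentModel E) β).symm y).1 = y.1 := by
  have hbs := (extChartAt (cotangentModel E) β).map_target hy
  have hmem : ∀ b ∈ (extChartAt (cotangentModel E) β).source, b.1 ∈ (chartAt E β.1).source := by
    intro b hb
    simp only [FiberBundle.chartedSpace_chartAt, mfld_simps] at hb
    exact hb.1.1
  refine ⟨hmem _ hbs, ?_⟩
  have hyb := (extChartAt (cotangentModel E) β).right_inv hy
  have hchart := hom_chart (HB := E) β ((extChartAt (cotangentModel E) β).symm y)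
  exact (congrArg Prod.fst hchart).symm.trans (congrArg Prod.fst hyb)

/-- In bundle coordinates `(q, p)`, the canonical one-form is `p dq`. -/
theorem inChart_canonicalOneForm (β : CotangentBundle E Q) {y : E × (E →L[ℝ] ℝ)}
    (hy : y ∈ (extChartAt (cotangentModel E) β).target) :
    DiffForm.inChart (canonicalOneForm E Q) β y =
      ContinuousAlternatingMap.ofSubsingleton ℝ (E × (E →L[ℝ] ℝ)) ℝ (0 : Fin 1)
        (y.2.comp (ContinuousLinearMap.fst ℝ E (E →L[ℝ] ℝ))) := by
  have : IsManifold 𝓘(ℝ, E) 1 Q := .of_le (n := ∞) (by simp)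
  set b := (extChartAt (cotangentModel E) β).symm y with hb
  have hyb : extChartAt (cotangentModel E) β b = y :=
    (extChartAt (cotangentModel E) β).right_inv hy
  have hchart : extChartAt (cotangentModel E) β b = (extChartAt 𝓘(ℝ, E) β.1 b.1,
      ContinuousLinearMap.inCoordinates E (TangentSpace 𝓘(ℝ, E)) ℝ (Bundle.Trivial Q ℝ)
        β.1 b.1 β.1 b.1 b.2) := by
    simpa [extChartAt] using hom_chart β b
  obtain ⟨hbs', hy1⟩ := proj_extChartAt_symm β hy
  have hy2 := congrArg Prod.snd (hchart.symm.trans hyb)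
  have hy1t : y.1 ∈ (extChartAt 𝓘(ℝ, E) β.1).target :=
    hy1 ▸ (extChartAt 𝓘(ℝ, E) β.1).map_source (by simpa using hbs')
  have hsymm := mdifferentiableWithinAt_extChartAt_symm (I := cotangentModel E) hy
  have hsymm1 := mdifferentiableWithinAt_extChartAt_symm (I := 𝓘(ℝ, E)) hy1t
  have hpr : MDifferentiableAt (cotangentModel E) 𝓘(ℝ, E)
      (Bundle.TotalSpace.proj : CotangentBundle E Q → Q) b :=
    contMDiff_proj.mdifferentiable (by simp) b
  have hyr : y ∈ range (cotangentModel E) := extChartAt_target_subset_range β hy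
  have hu : UniqueMDiffWithinAt 𝓘(ℝ, E × (E →L[ℝ] ℝ)) (range (cotangentModel E)) y :=
    ((cotangentModel E).uniqueDiffOn y hyr).uniqueMDiffWithinAt
  have h1 := mfderiv_comp_mfderivWithin y hpr hsymm hu
  have hfst : MDifferentiableWithinAt 𝓘(ℝ, E × (E →L[ℝ] ℝ)) 𝓘(ℝ, E)
      (Prod.fst : E × (E →L[ℝ] ℝ) → E) (range (cotangentModel E)) y :=
    differentiableAt_fst.mdifferentiableAt.mdifferentiableWithinAt
  have h2 := mfderivWithin_comp y hsymm1 hfst (fun z _ ↦ by simp) hu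
  have heq : (Bundle.TotalSpace.proj : CotangentBundle E Q → Q) ∘
      (extChartAt (cotangentModel E) β).symm =ᶠ[𝓝[range (cotangentModel E)] y]
        (extChartAt 𝓘(ℝ, E) β.1).symm ∘ Prod.fst := by
    have htarget : (extChartAt (cotangentModel E) β).target ∈ 𝓝 y :=
      extChartAt_target_mem_nhds' hy
    filter_upwards [mem_nhdsWithin_of_mem_nhds htarget] with z hz
    obtain ⟨hzs, hz1⟩ := proj_extChartAt_symm β hz
    simp only [Function.comp_apply]
    rw [← hz1, (extChartAt 𝓘(ℝ, E) β.1).left_inv (by simpa using hzs)]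
  rw [heq.mfderivWithin_eq_of_mem hyr] at h1
  have hfstd : ∀ w : E × (E →L[ℝ] ℝ), mfderivWithin 𝓘(ℝ, E × (E →L[ℝ] ℝ)) 𝓘(ℝ, E)
      (Prod.fst : E × (E →L[ℝ] ℝ) → E) (range (cotangentModel E)) y w = w.1 := fun w ↦ by
    rw [mfderivWithin_eq_fderivWithin, fderivWithin_fst (hu.uniqueDiffWithinAt)]
    rfl
  have htriv : ∀ (q q' : Q) (r : ℝ),
      (trivializationAt ℝ (Bundle.Trivial Q ℝ) q).continuousLinearMapAt ℝ q' r = r :=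
    fun q q' r ↦ by simp
  -- The inverse trivialization of the tangent bundle is the derivative of the inverse chart; hence
  -- `b.2`, pulled back along that derivative, is the fibre coordinate `y.2`.
  have hsL := TangentBundle.symmL_trivializationAt (I := 𝓘(ℝ, E)) hbs'
  rw [hy1] at hsL
  have hp : ∀ w : E, b.2 (mfderivWithin 𝓘(ℝ, E) 𝓘(ℝ, E) (extChartAt 𝓘(ℝ, E) β.1).symm
      (range 𝓘(ℝ, E)) y.1 w) = y.2 w := fun w ↦ by
    refine Eq.trans ?_ (DFunLike.congr_fun hy2 w)
    refine Eq.trans ?_ (htriv β.1 b.1 _).symm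
    exact congrArg b.2 (DFunLike.congr_fun hsL w).symm
  ext v
  change b.2 (mfderiv (cotangentModel E) 𝓘(ℝ, E)
    (Bundle.TotalSpace.proj : CotangentBundle E Q → Q) b
      (mfderivWithin 𝓘(ℝ, E × (E →L[ℝ] ℝ)) (cotangentModel E)
        (extChartAt (cotangentModel E) β).symm (range (cotangentModel E)) y (v 0))) =
    y.2 (v 0).1
  have e1 := (DFunLike.congr_fun h1 (v 0)).symm.trans (DFunLike.congr_fun h2 (v 0))
  refine (congrArg b.2 e1).trans ?_
  refine Eq.trans ?_ (hp (v 0).1)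
  exact congrArg (fun w ↦ b.2 (mfderivWithin 𝓘(ℝ, E) 𝓘(ℝ, E) (extChartAt 𝓘(ℝ, E) β.1).symm
      (range 𝓘(ℝ, E)) y.1 w)) (hfstd (v 0))

/-- Near the centre of the chart the expression p dq is linear in p and independent of q. -/
theorem differentiableWithinAt_inChart_canonicalOneForm (β : CotangentBundle E Q) :
    DifferentiableWithinAt ℝ (DiffForm.inChart (canonicalOneForm E Q) β)
      (range (cotangentModel E)) (extChartAt (cotangentModel E) β β) := by
  have hd : Differentiable ℝ fun y : E × (E →L[ℝ] ℝ) ↦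
      ContinuousAlternatingMap.ofSubsingleton ℝ (E × (E →L[ℝ] ℝ)) ℝ (0 : Fin 1)
        (y.2.comp (ContinuousLinearMap.fst ℝ E (E →L[ℝ] ℝ))) := by
    refine differentiable_ofSubsingleton_comp ?_
    fun_prop
  refine hd.differentiableAt.differentiableWithinAt.congr_of_eventuallyEq ?_
    (inChart_canonicalOneForm β (mem_extChartAt_target β))
  filter_upwards [extChartAt_target_mem_nhdsWithin β] with y hy
  exact inChart_canonicalOneForm β hy

theorem pullback_canonicalSymplecticForm (c : ℝ) (f : Q ≃ₘ^∞⟮𝓘(ℝ, E), 𝓘(ℝ, E')⟯ Q') :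
    DiffForm.pullback (cotangentModel E) (scaledCotangentLift c f)
      (canonicalSymplecticForm E' Q') = c • canonicalSymplecticForm E Q := by
  have h := DiffForm.extDeriv_pullback (canonicalOneForm E' Q')
    (contMDiff_scaledCotangentLift c f) differentiableWithinAt_inChart_canonicalOneForm
  rw [pullback_canonicalOneForm, DiffForm.extDeriv_smul] at h
  have hneg : DiffForm.pullback (cotangentModel E) (scaledCotangentLift c f)
      (canonicalSymplecticForm E' Q') = -DiffForm.pullback (cotangentModel E)
        (scaledCotangentLift c f) (DiffForm.extDeriv (canonicalOneForm E' Q')) := rfl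
  rw [hneg, ← h, canonicalSymplecticForm, smul_neg]

end CotangentLift

end ConformalSymplectic

end

theorem mainTheorem10
    {E₁ : Type*} [NormedAddCommGroup E₁] [NormedSpace ℝ E₁] [FiniteDimensional ℝ E₁]
    {E₂ : Type*} [NormedAddCommGroup E₂] [NormedSpace ℝ E₂] [FiniteDimensional ℝ E₂]
    {Q₁ : Type*} [TopologicalSpace Q₁] [ChartedSpace E₁ Q₁] [IsManifold 𝓘(ℝ, E₁) ∞ Q₁]
    {Q₂ : Type*} [TopologicalSpace Q₂] [ChartedSpace E₂ Q₂] [IsManifold 𝓘(ℝ, E₂) ∞ Q₂]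
    (f : Q₁ ≃ₘ^∞⟮𝓘(ℝ, E₁), 𝓘(ℝ, E₂)⟯ Q₂) (c : ℝ) :
    ContMDiff (ConformalSymplectic.cotangentModel E₁) (ConformalSymplectic.cotangentModel E₂) ∞
      (ConformalSymplectic.scaledCotangentLift c f) ∧
    ConformalSymplectic.DiffForm.pullback (ConformalSymplectic.cotangentModel E₁)
        (ConformalSymplectic.scaledCotangentLift c f)
        (ConformalSymplectic.canonicalOneForm E₂ Q₂) =
      c • ConformalSymplectic.canonicalOneForm E₁ Q₁ ∧
    ConformalSymplectic.DiffForm.pullback (ConformalSymplectic.cotangentModel E₁)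
        (ConformalSymplectic.scaledCotangentLift c f)
        (ConformalSymplectic.canonicalSymplecticForm E₂ Q₂) =
      c • ConformalSymplectic.canonicalSymplecticForm E₁ Q₁ ∧
    (0 < c → ConformalSymplectic.IsConformallySymplectic
      (ConformalSymplectic.canonicalSymplecticForm E₁ Q₁)
      (ConformalSymplectic.canonicalSymplecticForm E₂ Q₂) c
      (ConformalSymplectic.scaledCotangentLift c f)) := by
  have h := ConformalSymplectic.contMDiff_scaledCotangentLift c f
  have hω := ConformalSymplectic.pullback_canonicalSymplecticForm c f
  exact ⟨h, ConformalSymplectic.pullback_canonicalOneForm c f, hω, fun hc ↦ ⟨h, hc, hω⟩⟩
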